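/- Let $d\ge 1$ and let $(X_t)_{t\ge0}$, under the laws $(\mathbb P^x)_{x\in\mathbb R^d}$, be a conservative Feller process in $\mathbb R^d$. That is, $(X_t)$ is a Markov process with càdlàg paths in $\mathbb R^d$ (infinite life time), with $\mathbb P^x(X_0=x)=1$, whose operators $T_tu(x)=\mathbb E^x[u(X_t)]$ map the space $C_\infty(\mathbb R^d)$ of continuous functions vanishing at infinity into itself and satisfy $\lim_{t\to0}\|T_tu-u\|_\infty=0$ for every $u\in C_\infty(\mathbb R^d)$. Suppose that $(X_t)$ has a transition probability density $p(t,x,y)$ (with respect to Lebesgue measure, for all $t>0$), and that for some $\alpha\in(0,2)$ and some constant $c$ $$p(t,x,y)\le c\,t^{-d/\alpha},\qquad t\in(0,1],\ x,y\in\mathbb R^d .$$ Then for every analytic set $E\subset[0,1]$ and every starting point $x\in\mathbb R^d$, $$\dim_H X(E)\ \ge\ (\alpha\wedge d)\,\dim_H E\qquad \mathbb P^x\text{-almost surely},$$ where $X(E)=\{X_t: t\in E\}$ and $\dim_H$ denotes Hausdorff dimension. -/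

import Mathlib

open MeasureTheory ProbabilityTheory Filter Set Topology
open scoped NNReal ENNReal ZeroAtInfty

/-- A path `f : [0, ∞) → S` is càdlàg: right-continuous with left limits in `S`
(at `t = 0` the condition on the left limit is void). -/
def IsCadlagPath {S : Type*} [TopologicalSpace S] (f : ℝ≥0 → S) : Prop :=
  ∀ t : ℝ≥0, ContinuousWithinAt f (Ici t) t ∧ ∃ l : S, Tendsto f (𝓝[<] t) (𝓝 l)

/-- The operators `T_t u (x) = 𝔼^x [u (X_t)]` of a family `(X_t)` under the laws `(ℙ^x)`. -/
noncomputable def transitionOperator {d : ℕ} {Ω : Type*} [MeasurableSpace Ω]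
    (P : EuclideanSpace ℝ (Fin d) → Measure Ω) (X : ℝ≥0 → Ω → EuclideanSpace ℝ (Fin d))
    (t : ℝ≥0) (u : EuclideanSpace ℝ (Fin d) → ℝ) (x : EuclideanSpace ℝ (Fin d)) : ℝ :=
  ∫ ω, u (X t ω) ∂(P x)

/-- A (conservative) Feller process with state space `ℝ^d`: a Markov process
`(Ω, 𝓐, (X_t)_{t ≥ 0}, (ℙ^x)_{x ∈ ℝ^d})` with càdlàg paths in `ℝ^d` whose transition operators
form a Feller semigroup on `C_∞(ℝ^d)`, the continuous functions vanishing at infinity.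

Conservativeness (infinite life time) is the fact that the `ℙ^x` are probability measures and that
`X_t` takes its values in `ℝ^d`. The Markov property is required for the natural filtration only,
which is the weakest form of it. That the `T_t` are linear, positive, sub-Markovian contractions
is automatic, the semigroup property follows from the Markov property, and the strong Markov
property follows from the fields below, so none of these is listed. -/
structure IsFellerProcess {d : ℕ} {Ω : Type*} [MeasurableSpace Ω]
    (P : EuclideanSpace ℝ (Fin d) → Measure Ω) (X : ℝ≥0 → Ω → EuclideanSpace ℝ (Fin d)) :
    Prop where
  /-- every `ℙ^x` is a probability measure -/
  isProbabilityMeasure : ∀ x, IsProbabilityMeasure (P x)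
  /-- every `X_t` is a random variable -/
  measurable : ∀ t, Measurable (X t)
  /-- under `ℙ^x` the process starts at `x` -/
  start : ∀ x, ∀ᵐ ω ∂(P x), X 0 ω = x
  /-- `ℙ^x`-almost all paths are càdlàg -/
  cadlag : ∀ x, ∀ᵐ ω ∂(P x), IsCadlagPath (fun t => X t ω)
  /-- the Markov property: `ℙ^x (X_{s+t} ∈ B | σ(X_r, r ≤ s)) = ℙ^{X_s} (X_t ∈ B)` a.s. -/
  markov : ∀ (x : EuclideanSpace ℝ (Fin d)) (s t : ℝ≥0) (B : Set (EuclideanSpace ℝ (Fin d))),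
    MeasurableSet B →
      (P x)⟦X (s + t) ⁻¹' B | Filtration.natural X (fun r => (measurable r).stronglyMeasurable) s⟧
        =ᵐ[P x] fun ω => (P (X s ω)).real (X t ⁻¹' B)
  /-- the Feller property: `T_t` maps `C_∞(ℝ^d)` into itself -/
  feller : ∀ (t : ℝ≥0) (u : C₀(EuclideanSpace ℝ (Fin d), ℝ)),
    ∃ v : C₀(EuclideanSpace ℝ (Fin d), ℝ), ∀ x, transitionOperator P X t u x = v x
  /-- strong continuity: `T_t u → u` uniformly on `ℝ^d` as `t → 0` -/
  strongly_continuous : ∀ u : C₀(EuclideanSpace ℝ (Fin d), ℝ),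
    TendstoUniformly (fun (t : ℝ≥0) x => transitionOperator P X t u x) u (𝓝[>] 0)

/-- `p (t, x, y)` is a transition probability density of the process: for all `t > 0` and `x`,
`ℙ^x (X_t ∈ B) = ∫_B p (t, x, y) dy` for all Borel sets `B`. -/
structure IsTransitionDensity {d : ℕ} {Ω : Type*} [MeasurableSpace Ω]
    (P : EuclideanSpace ℝ (Fin d) → Measure Ω) (X : ℝ≥0 → Ω → EuclideanSpace ℝ (Fin d))
    (p : ℝ≥0 → EuclideanSpace ℝ (Fin d) → EuclideanSpace ℝ (Fin d) → ℝ) : Prop where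
  measurable : ∀ t, 0 < t → ∀ x, Measurable (p t x)
  nonneg : ∀ t, 0 < t → ∀ x y, 0 ≤ p t x y
  law : ∀ t, 0 < t → ∀ (x : EuclideanSpace ℝ (Fin d)) (B : Set (EuclideanSpace ℝ (Fin d))),
    MeasurableSet B → P x (X t ⁻¹' B) = ∫⁻ y in B, ENNReal.ofReal (p t x y)

/-! The proof is the energy method. Let `0 < b < (α ∧ d) dim E`; since `dim E ≤ 1`, this gives both
`b < d` and `b / α < dim E`. Frostman's lemma provides a nonzero finite measure `μ` carried by `E`
with `μ (B(u, r)) ≤ C r ^ γ` for some `γ > b / α`. The Markov property and the density bound give `ℙ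
(|X_u - X_v| ≤ r) ≤ c' |u - v| ^ (-d/α) r ^ d`, and integrating over scales, with cutoff `|u - v| ^
(1/α)`, yields `𝔼 |X_u - X_v| ^ (-b) ≤ A |u - v| ^ (-b/α)` because `b < d`
(`lintegral_edist_rpow_neg_le`). As `γ > b / α`, the right side is `μ ⊗ μ`-integrable. By Tonelli
the image of `μ` under almost every path has finite `b`-energy, so `dim X(E) ≥ b`
(`le_dimH_image_of_energy_ne_top`); rational `b` suffice.

Frostman's lemma for analytic `E` rests on the dyadic net content. On a tree this content is
strongly subadditive, hence continuous along increasing sequences of arbitrary sets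
(`content_iUnion_le`). Capacitability then gives a compact `K ⊆ E` of positive content. Splitting
mass down the tree in proportion to the content of `K` in each dyadic interval produces `μ`. -/

namespace TreeContent

/-! ### Contents on a tree -/

variable {α : Type*}

/-- The points having an address in the set `V` of nodes; the address of `x` at level `n` is the
node `(n, a x n)`. -/
def cov (a : α → ℕ → ℕ) (V : Set (ℕ × ℕ)) : Set α := {x | ∃ n, (n, a x n) ∈ V}

/-- The nodes of `V` none of whose strict ancestors belongs to `V`. -/
def top (a : α → ℕ → ℕ) (V : Set (ℕ × ℕ)) : Set (ℕ × ℕ) :=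
  {v ∈ V | ∀ x, a x v.1 = v.2 → ∀ m < v.1, (m, a x m) ∉ V}

/-- The total weight of a set of nodes. -/
noncomputable def cost (w : ℕ × ℕ → ℝ≥0∞) (V : Set (ℕ × ℕ)) : ℝ≥0∞ := ∑' v, V.indicator w v

/-- The content of a set: the least cost of a cover by nodes. -/
noncomputable def content (a : α → ℕ → ℕ) (w : ℕ × ℕ → ℝ≥0∞) (A : Set α) : ℝ≥0∞ :=
  ⨅ (V : Set (ℕ × ℕ)) (_ : A ⊆ cov a V), cost w V

variable {a : α → ℕ → ℕ} {w : ℕ × ℕ → ℝ≥0∞}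

lemma content_le_cost {A : Set α} {V : Set (ℕ × ℕ)} (h : A ⊆ cov a V) :
    content a w A ≤ cost w V := iInf₂_le V h

lemma exists_cover_of_content_lt {A : Set α} {c : ℝ≥0∞} (h : content a w A < c) :
    ∃ V, A ⊆ cov a V ∧ cost w V < c := by
  simpa only [content, iInf_lt_iff, exists_prop] using h

lemma content_mono {A B : Set α} (h : A ⊆ B) : content a w A ≤ content a w B :=
  le_iInf₂ fun _ hV => content_le_cost (h.trans hV)

lemma content_empty : content a w ∅ = 0 := by
  refine le_antisymm ((content_le_cost (V := ∅) (empty_subset _)).trans ?_) zero_le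
  simp [cost]

lemma content_le_weight {A : Set α} {v : ℕ × ℕ} (h : ∀ x ∈ A, a x v.1 = v.2) :
    content a w A ≤ w v := by
  refine (content_le_cost (V := {v}) fun x hx => ⟨v.1, ?_⟩).trans ?_
  · rw [h x hx]; rfl
  · rw [cost, tsum_eq_single v]
    · simp
    · intro u hu
      simp [hu]

lemma cost_union_le (V W : Set (ℕ × ℕ)) : cost w (V ∪ W) ≤ cost w V + cost w W := by
  rw [cost, cost, cost, ← ENNReal.tsum_add]
  refine ENNReal.tsum_le_tsum fun v => ?_
  by_cases h1 : v ∈ V <;> by_cases h2 : v ∈ W <;> simp [h1, h2]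

lemma cov_union (V W : Set (ℕ × ℕ)) : cov a (V ∪ W) = cov a V ∪ cov a W := by
  ext x
  simp only [cov, mem_ofPred_eq, mem_union, exists_or]

lemma content_union_le (A B : Set α) :
    content a w (A ∪ B) ≤ content a w A + content a w B := by
  refine ENNReal.le_of_forall_pos_le_add fun ε hε hlt => ?_
  have hε2 : (ε : ℝ≥0∞) / 2 ≠ 0 := by simp [hε.ne']
  obtain ⟨hA, hB⟩ := ENNReal.add_lt_top.1 hlt
  obtain ⟨V, hV, hVc⟩ := exists_cover_of_content_lt (ENNReal.lt_add_right hA.ne hε2)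
  obtain ⟨W, hW, hWc⟩ := exists_cover_of_content_lt (ENNReal.lt_add_right hB.ne hε2)
  refine (content_le_cost (V := V ∪ W) ?_).trans <| (cost_union_le V W).trans <|
    (add_le_add hVc.le hWc.le).trans ?_
  · rw [cov_union]; exact union_subset_union hV hW
  · rw [add_add_add_comm, ENNReal.add_halves]

/-- Addresses are coherent: the address at level `n + 1` determines the one at level `n`. -/
def Coherent (a : α → ℕ → ℕ) : Prop := ∀ x y n, a x (n + 1) = a y (n + 1) → a x n = a y n

lemma Coherent.eq_of_le (ha : Coherent a) {x y : α} {m n : ℕ} (hmn : m ≤ n)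
    (h : a x n = a y n) : a x m = a y m := by
  induction n, hmn using Nat.le_induction with
  | base => exact h
  | succ n _ ih => exact ih (ha x y n h)

lemma mem_top_of_min (ha : Coherent a) {V : Set (ℕ × ℕ)} {x : α} {n : ℕ}
    (h : (n, a x n) ∈ V) (hmin : ∀ m < n, (m, a x m) ∉ V) : (n, a x n) ∈ top a V := by
  refine ⟨h, fun y hy m hm => ?_⟩
  rw [ha.eq_of_le hm.le hy]
  exact hmin m hm

lemma exists_le_mem_top (ha : Coherent a) {V : Set (ℕ × ℕ)} {x : α} {n : ℕ}
    (h : (n, a x n) ∈ V) : ∃ m ≤ n, (m, a x m) ∈ top a V := by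
  classical
  have hex : ∃ n, (n, a x n) ∈ V := ⟨n, h⟩
  exact ⟨Nat.find hex, Nat.find_min' hex h,
    mem_top_of_min ha (Nat.find_spec hex) fun m hm => Nat.find_min hex hm⟩

lemma cov_subset_cov_top (ha : Coherent a) (V : Set (ℕ × ℕ)) : cov a V ⊆ cov a (top a V) := by
  rintro x ⟨n, hn⟩
  obtain ⟨m, -, hm⟩ := exists_le_mem_top ha hn
  exact ⟨m, hm⟩

/-- Strong subadditivity of the content. -/
lemma cost_top_add_content_le (V W : Set (ℕ × ℕ)) {A : Set α}
    (hV : A ⊆ cov a V) (hW : A ⊆ cov a W) :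
    cost w (top a (V ∪ W)) + content a w A ≤ cost w V + cost w W := by
  -- `T` is what remains of `V` and `W`, counted with multiplicity, once the top nodes are removed.
  -- It still covers `A`: of the two nodes above a point, the deeper one is not top, and if they
  -- coincide they lie in `V ∩ W`.
  set T := ((V ∪ W) \ top a (V ∪ W)) ∪ (V ∩ W) with hT
  have hcov : A ⊆ cov a T := by
    intro x hx
    obtain ⟨n, hn⟩ := hV hx
    obtain ⟨m, hm⟩ := hW hx
    rcases lt_trichotomy m n with h | h | h
    · refine ⟨n, Or.inl ⟨Or.inl hn, fun ht => ht.2 x rfl m h (Or.inr hm)⟩⟩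
    · subst h
      exact ⟨m, Or.inr ⟨hn, hm⟩⟩
    · refine ⟨m, Or.inl ⟨Or.inr hm, fun ht => ht.2 x rfl n h (Or.inl hn)⟩⟩
  refine (add_le_add le_rfl (content_le_cost hcov)).trans ?_
  rw [cost, cost, cost, cost, ← ENNReal.tsum_add, ← ENNReal.tsum_add]
  refine ENNReal.tsum_le_tsum fun v => ?_
  have hsub : v ∈ top a (V ∪ W) → v ∈ V ∪ W := fun h => h.1
  by_cases h1 : v ∈ V <;> by_cases h2 : v ∈ W <;> by_cases h3 : v ∈ top a (V ∪ W) <;>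
    simp_all

/-- Nodes that are the first of a finite union of covers, built one cover at a time. -/
def accum (a : α → ℕ → ℕ) (V : ℕ → Set (ℕ × ℕ)) : ℕ → Set (ℕ × ℕ)
  | 0 => V 0
  | n + 1 => top a (accum a V n ∪ V (n + 1))

lemma subset_cov_accum (ha : Coherent a) {A : ℕ → Set α} {V : ℕ → Set (ℕ × ℕ)}
    (hV : ∀ n, A n ⊆ cov a (V n)) (n : ℕ) : A n ⊆ cov a (accum a V n) := by
  cases n with
  | zero => exact hV 0
  | succ n =>
    refine Subset.trans ?_ (cov_subset_cov_top ha _)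
    rw [cov_union]
    exact (hV (n + 1)).trans subset_union_right

/-- Both the accumulated cover and the next one cover `A n`, so strong subadditivity allows the
finite content of `A n` to be cancelled. Only the errors `ε i` add up, not the costs. -/
lemma cost_accum_le (ha : Coherent a) {A : ℕ → Set α} (hA : Monotone A) {V : ℕ → Set (ℕ × ℕ)}
    (hV : ∀ n, A n ⊆ cov a (V n)) {ε : ℕ → ℝ≥0∞}
    (hc : ∀ n, cost w (V n) ≤ content a w (A n) + ε n) (hfin : ∀ n, content a w (A n) ≠ ∞) (n : ℕ) :
    cost w (accum a V n) ≤ content a w (A n) + ∑ i ∈ Finset.range (n + 1), ε i := by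
  induction n with
  | zero => simpa [accum] using hc 0
  | succ n ih =>
    have h := cost_top_add_content_le (w := w) (accum a V n) (V (n + 1))
      (subset_cov_accum ha hV n) ((hA n.le_succ).trans (hV (n + 1)))
    have h2 := h.trans (add_le_add ih (hc (n + 1)))
    rw [Finset.sum_range_succ]
    refine (ENNReal.add_le_add_iff_right (hfin n)).1 (h2.trans (le_of_eq ?_))
    ring

/-- The content is continuous along increasing sequences of arbitrary sets. -/
theorem content_iUnion_le (ha : Coherent a) {A : ℕ → Set α} (hA : Monotone A) {L : ℝ≥0∞}
    (hL : ∀ n, content a w (A n) ≤ L) : content a w (⋃ n, A n) ≤ L := by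
  refine ENNReal.le_of_forall_pos_le_add fun δ hδ hLt => ?_
  have hfin : ∀ n, content a w (A n) ≠ ∞ := fun n => ((hL n).trans_lt hLt).ne
  obtain ⟨ε, hε, hsum⟩ := ENNReal.exists_pos_sum_of_countable'
    (ENNReal.coe_ne_zero.2 hδ.ne') ℕ
  choose V hV hVc using fun n =>
    exists_cover_of_content_lt (ENNReal.lt_add_right (hfin n) (hε n).ne')
  have hcost : ∀ n, cost w (accum a V n) ≤ L + δ := fun n =>
    (cost_accum_le ha hA hV (fun n => (hVc n).le) hfin n).trans
      (add_le_add (hL n) ((ENNReal.sum_le_tsum _).trans hsum.le))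
  -- On each branch, passing to the next accumulated cover can only move a covering node towards the
  -- root. The node of least level ever attained therefore stays forever. Any finite part of `W`
  -- lies in a single accumulated cover, which bounds the cost.
  set W : Set (ℕ × ℕ) := {v | ∀ᶠ n in atTop, v ∈ accum a V n} with hW
  have hcov : (⋃ n, A n) ⊆ cov a W := by
    intro x hx
    obtain ⟨N, hN⟩ := mem_iUnion.1 hx
    have hstep : ∀ n ℓ, (ℓ, a x ℓ) ∈ accum a V n →
        ∃ m ≤ ℓ, (m, a x m) ∈ accum a V (n + 1) := fun n ℓ h =>
      exists_le_mem_top ha (Or.inl h)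
    obtain ⟨ℓ₀, hℓ₀⟩ := subset_cov_accum ha hV N hN
    classical
    have hex : ∃ ℓ, ∃ n, (ℓ, a x ℓ) ∈ accum a V n := ⟨ℓ₀, N, hℓ₀⟩
    obtain ⟨n₀, hn₀⟩ := Nat.find_spec hex
    refine ⟨Nat.find hex, eventually_atTop.2 ⟨n₀, fun n hn => ?_⟩⟩
    induction n, hn using Nat.le_induction with
    | base => exact hn₀
    | succ n _ ih =>
      obtain ⟨m, hm, hmem⟩ := hstep n _ ih
      have := Nat.find_min' hex ⟨n + 1, hmem⟩
      rwa [le_antisymm hm this] at hmem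
  refine (content_le_cost hcov).trans ?_
  rw [cost, ENNReal.tsum_eq_iSup_sum]
  refine iSup_le fun s => ?_
  have hev : ∀ᶠ n in atTop, ∀ v ∈ s, v ∈ W → v ∈ accum a V n := by
    refine (Finset.eventually_all s).2 fun v _ => ?_
    by_cases hv : v ∈ W
    · exact Eventually.mono hv fun n h _ => h
    · exact Eventually.of_forall fun n h => absurd h hv
  obtain ⟨n, hn⟩ := hev.exists
  refine le_trans (Finset.sum_le_sum fun v hv => ?_) ((ENNReal.sum_le_tsum s).trans (hcost n))
  by_cases hvW : v ∈ W
  · simp [hvW, hn v hv hvW]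
  · simp [hvW]

end TreeContent

/-! ### Capacitability -/

/-- Capacitability of analytic sets: if `Φ` is monotone and continuous along increasing sequences,
a continuous image of the Baire space contains a compact set whose open neighbourhoods
are all at least as large as prescribed. -/
theorem exists_isCompact_forall_isOpen_lt {X : Type*} [TopologicalSpace X]
    {Φ : Set X → ℝ≥0∞} (hmono : ∀ A B, A ⊆ B → Φ A ≤ Φ B)
    (hincr : ∀ A : ℕ → Set X, Monotone A → ∀ L, (∀ n, Φ (A n) ≤ L) → Φ (⋃ n, A n) ≤ L)
    {g : (ℕ → ℕ) → X} (hg : Continuous g) {c : ℝ≥0∞} (hc : c < Φ (range g)) :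
    ∃ K ⊆ range g, IsCompact K ∧ ∀ U, IsOpen U → K ⊆ U → c < Φ U := by
  have step : ∀ (k : ℕ) (S : Set (ℕ → ℕ)), ∃ m : ℕ, c < Φ (g '' S) →
      c < Φ (g '' (S ∩ {σ | σ k ≤ m})) := by
    intro k S
    by_contra! h
    have hS : g '' S = ⋃ m, g '' (S ∩ {σ | σ k ≤ m}) := by
      rw [← image_iUnion, ← inter_iUnion]
      congr 1
      ext σ
      simp only [mem_inter_iff, mem_iUnion, mem_ofPred_eq]
      exact ⟨fun h => ⟨h, _, le_rfl⟩, fun h => h.1⟩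
    refine (h 0).1.not_ge ?_
    rw [hS]
    refine hincr _ (fun m m' hm => image_mono ?_) c fun n => (h n).2
    exact fun σ hσ => ⟨hσ.1, le_trans (b := m) hσ.2 hm⟩
  choose m hm using step
  let S : ℕ → Set (ℕ → ℕ) := Nat.rec univ fun k S => S ∩ {σ | σ k ≤ m k S}
  have hSs : ∀ k, S (k + 1) = S k ∩ {σ | σ k ≤ m k (S k)} := fun k => rfl
  have hSc : ∀ k, c < Φ (g '' S k) := by
    intro k
    induction k with
    | zero => simpa [S] using hc
    | succ k ih => rw [hSs]; exact hm k _ ih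
  set b : ℕ → ℕ := fun k => m k (S k) with hb
  have hSb : ∀ k σ, σ ∈ S k ↔ ∀ i < k, σ i ≤ b i := by
    intro k
    induction k with
    | zero => simp [S]
    | succ k ih =>
      intro σ
      rw [hSs, mem_inter_iff, ih]
      simp only [Nat.lt_succ_iff_lt_or_eq, or_imp, forall_and, forall_eq, mem_ofPred_eq, hb]
  have hC : IsCompact (Set.univ.pi fun i => Iic (b i)) :=
    isCompact_univ_pi fun i => (Set.finite_Iic (b i)).isCompact
  refine ⟨g '' (Set.univ.pi fun i => Iic (b i)), image_subset_range _ _, hC.image hg,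
    fun U hU hKU => ?_⟩
  suffices h : ∃ k, g '' S k ⊆ U by
    obtain ⟨k, hk⟩ := h
    exact (hSc k).trans_le (hmono _ _ hk)
  -- Points `σ k ∈ S k` with `g (σ k) ∉ U` need not lie in the compact box, but their truncations by
  -- `b` do. A truncation changes no coordinate below `k`, so a convergent subsequence of
  -- truncations forces the same limit for the `σ k`.
  by_contra! h
  have h' : ∀ k, ∃ σ ∈ S k, g σ ∉ U := by
    intro k
    obtain ⟨y, ⟨σ, hσ, rfl⟩, hy⟩ := not_subset.1 (h k)
    exact ⟨σ, hσ, hy⟩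
  choose σ hσ hσU using h'
  have hτ : ∀ k, (fun i => min (σ k i) (b i)) ∈ Set.univ.pi fun i => Iic (b i) :=
    fun k i _ => mem_Iic.2 (min_le_right _ _)
  obtain ⟨τ, hτC, φ, hφ, hlim⟩ := hC.tendsto_subseq hτ
  have hlim' : Tendsto (σ ∘ φ) atTop (𝓝 τ) := by
    rw [tendsto_pi_nhds] at hlim ⊢
    intro i
    refine (hlim i).congr' ?_
    filter_upwards [eventually_gt_atTop i] with k hk
    exact min_eq_left ((hSb _ _).1 (hσ (φ k)) i (hk.trans_le (hφ.id_le k)))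
  have hcl : IsClosed (g ⁻¹' Uᶜ) := (hU.isClosed_compl).preimage hg
  have := hcl.mem_of_tendsto hlim' (Eventually.of_forall fun k => hσU (φ k))
  exact this (hKU ⟨τ, hτC, rfl⟩)

/-! ### Mass distributions on the dyadic tree and their measures -/

/-- The mass distribution on the dyadic tree obtained by splitting the mass of a node among its two
children proportionally to `f`. -/
noncomputable def splitMass (f : ℕ → ℕ → ℝ≥0) : ℕ → ℕ → ℝ≥0
  | 0, k => f 0 k
  | n + 1, k =>
    splitMass f n (k / 2) * (f (n + 1) k / (f (n + 1) (2 * (k / 2)) + f (n + 1) (2 * (k / 2) + 1)))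

lemma splitMass_le {f : ℕ → ℕ → ℝ≥0}
    (hf : ∀ n k, f n k ≤ f (n + 1) (2 * k) + f (n + 1) (2 * k + 1)) (n k : ℕ) :
    splitMass f n k ≤ f n k := by
  induction n generalizing k with
  | zero => exact le_rfl
  | succ n ih =>
    rw [splitMass]
    set D := f (n + 1) (2 * (k / 2)) + f (n + 1) (2 * (k / 2) + 1)
    calc splitMass f n (k / 2) * (f (n + 1) k / D) ≤ D * (f (n + 1) k / D) := by
          gcongr
          exact (ih _).trans (hf n _)
      _ ≤ f (n + 1) k := by
          rcases eq_or_ne D 0 with h | h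
          · simp [h]
          · rw [mul_div_cancel₀ _ h]

lemma splitMass_add {f : ℕ → ℕ → ℝ≥0}
    (hf : ∀ n k, f n k ≤ f (n + 1) (2 * k) + f (n + 1) (2 * k + 1)) (n k : ℕ) :
    splitMass f (n + 1) (2 * k) + splitMass f (n + 1) (2 * k + 1) = splitMass f n k := by
  have h1 : 2 * k / 2 = k := by omega
  have h2 : (2 * k + 1) / 2 = k := by omega
  rw [splitMass, splitMass, h1, h2, ← mul_add, ← add_div]
  rcases eq_or_ne (f (n + 1) (2 * k) + f (n + 1) (2 * k + 1)) 0 with h | h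
  -- Here the quotient is `0 / 0 = 0`, but no mass is lost: the parent has none.
  · have h0 : splitMass f n k = 0 := by
      have := (splitMass_le hf n k).trans (hf n k)
      rw [h] at this
      exact le_antisymm this zero_le
    rw [h0, zero_mul]
  · rw [div_self h, mul_one]

/-- The index at level `n` of the dyadic interval containing `x`. -/
noncomputable def dyadicAddr (x : ℝ≥0) (n : ℕ) : ℕ := ⌊x * 2 ^ n⌋₊

lemma dyadicAddr_succ_div_two (x : ℝ≥0) (n : ℕ) : dyadicAddr x (n + 1) / 2 = dyadicAddr x n := by
  rw [dyadicAddr, dyadicAddr, ← Nat.floor_div_natCast, pow_succ, ← mul_assoc]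
  congr 1
  rw [Nat.cast_ofNat, mul_div_cancel_right₀ _ (two_ne_zero)]

lemma dyadicAddr_coherent : TreeContent.Coherent dyadicAddr := fun x y n h => by
  rw [← dyadicAddr_succ_div_two, h, dyadicAddr_succ_div_two]

lemma dyadicAddr_mono {x y : ℝ≥0} (h : x ≤ y) (n : ℕ) : dyadicAddr x n ≤ dyadicAddr y n := by
  unfold dyadicAddr; gcongr

lemma dyadicAddr_natCast_div (n m j : ℕ) : dyadicAddr (j / 2 ^ n) (n + m) = j * 2 ^ m := by
  rw [dyadicAddr, pow_add, ← mul_assoc, div_mul_cancel₀ _ (by positivity)]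
  exact_mod_cast Nat.floor_natCast (R := ℝ≥0) (j * 2 ^ m)

lemma dyadicAddr_eq_iff {x : ℝ≥0} {n k : ℕ} :
    dyadicAddr x n = k ↔ (k : ℝ≥0) ≤ x * 2 ^ n ∧ x * 2 ^ n < k + 1 :=
  Nat.floor_eq_iff zero_le

lemma edist_le_of_dyadicAddr_eq {x y : ℝ≥0} {n k : ℕ} (hx : dyadicAddr x n = k)
    (hy : dyadicAddr y n = k) : edist x y ≤ ((2⁻¹ ^ n : ℝ≥0) : ℝ≥0∞) := by
  rw [dyadicAddr_eq_iff] at hx hy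
  rw [edist_nndist, ENNReal.coe_le_coe, ← NNReal.coe_le_coe, coe_nndist, NNReal.dist_eq]
  have h2 : (0 : ℝ) < 2 ^ n := by positivity
  have hx1 : (k : ℝ) ≤ x * 2 ^ n := by exact_mod_cast hx.1
  have hx2 : (x : ℝ) * 2 ^ n < k + 1 := by exact_mod_cast hx.2
  have hy1 : (k : ℝ) ≤ y * 2 ^ n := by exact_mod_cast hy.1
  have hy2 : (y : ℝ) * 2 ^ n < k + 1 := by exact_mod_cast hy.2
  have : |(x : ℝ) - y| * 2 ^ n ≤ 1 := by
    rw [← abs_of_pos h2, ← abs_mul, abs_le]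
    constructor <;> linarith
  push_cast
  rw [inv_pow, ← one_div, le_div_iff₀ h2]
  exact this

section Stieltjes

variable {m : ℕ → ℕ → ℝ≥0}

lemma sum_range_two_mul (hm : ∀ n k, m (n + 1) (2 * k) + m (n + 1) (2 * k + 1) = m n k) (n j : ℕ) :
    ∑ k ∈ Finset.range (2 * j), (m (n + 1) k : ℝ) = ∑ k ∈ Finset.range j, (m n k : ℝ) := by
  induction j with
  | zero => simp
  | succ j ih =>
    rw [mul_add, mul_one, Finset.sum_range_succ, Finset.sum_range_succ, Finset.sum_range_succ, ih,
      ← hm n j]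
    push_cast
    ring

lemma sum_range_mono (n : ℕ) : Monotone fun j => ∑ k ∈ Finset.range j, (m n k : ℝ) :=
  fun _ _ h => Finset.sum_le_sum_of_subset_of_nonneg (Finset.range_mono h) fun _ _ _ => by positivity

/-- Distribution function of the mass distribution `m` at scale `n`. -/
noncomputable def dyadicDistrib (m : ℕ → ℕ → ℝ≥0) (n : ℕ) (x : ℝ≥0) : ℝ :=
  ∑ k ∈ Finset.range (dyadicAddr x n), (m n k : ℝ)

lemma dyadicDistrib_mono_nat (hm : ∀ n k, m (n + 1) (2 * k) + m (n + 1) (2 * k + 1) = m n k)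
    (x : ℝ≥0) : Monotone fun n => dyadicDistrib m n x := by
  refine monotone_nat_of_le_succ fun n => ?_
  simp only [dyadicDistrib]
  rw [← sum_range_two_mul hm]
  refine sum_range_mono (n + 1) ?_
  have := dyadicAddr_succ_div_two x n
  omega

lemma sum_range_succ_antitone (hm : ∀ n k, m (n + 1) (2 * k) + m (n + 1) (2 * k + 1) = m n k)
    (x : ℝ≥0) : Antitone fun n => ∑ k ∈ Finset.range (dyadicAddr x n + 1), (m n k : ℝ) := by
  refine antitone_nat_of_succ_le fun n => ?_
  rw [← sum_range_two_mul hm n (dyadicAddr x n + 1)]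
  refine sum_range_mono (n + 1) ?_
  have := dyadicAddr_succ_div_two x n
  omega

/-- Lower sums increase and upper sums decrease under refinement, so any two are compared at a
common level. -/
lemma dyadicDistrib_le (hm : ∀ n k, m (n + 1) (2 * k) + m (n + 1) (2 * k + 1) = m n k)
    (x : ℝ≥0) (i n : ℕ) :
    dyadicDistrib m i x ≤ ∑ k ∈ Finset.range (dyadicAddr x n + 1), (m n k : ℝ) :=
  calc dyadicDistrib m i x ≤ dyadicDistrib m (max i n) x :=
        dyadicDistrib_mono_nat hm x (le_max_left _ _)
    _ ≤ ∑ k ∈ Finset.range (dyadicAddr x (max i n) + 1), (m (max i n) k : ℝ) :=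
        sum_range_mono _ (Nat.le_succ _)
    _ ≤ _ := sum_range_succ_antitone hm x (le_max_right _ _)

lemma bddAbove_dyadicDistrib (hm : ∀ n k, m (n + 1) (2 * k) + m (n + 1) (2 * k + 1) = m n k)
    (x : ℝ≥0) : BddAbove (range fun n => dyadicDistrib m n x) :=
  ⟨_, by rintro _ ⟨i, rfl⟩; exact dyadicDistrib_le hm x i 0⟩

lemma iSup_dyadicDistrib_natCast_div
    (hm : ∀ n k, m (n + 1) (2 * k) + m (n + 1) (2 * k + 1) = m n k) (n j : ℕ) :
    ⨆ i, dyadicDistrib m i (j / 2 ^ n) = ∑ k ∈ Finset.range j, (m n k : ℝ) := by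
  have key : ∀ i, dyadicDistrib m (n + i) (j / 2 ^ n) = ∑ k ∈ Finset.range j, (m n k : ℝ) := by
    intro i
    rw [dyadicDistrib, dyadicAddr_natCast_div]
    induction i with
    | zero => simp
    | succ i ih => rw [← ih, ← sum_range_two_mul hm (n + i), ← add_assoc, pow_succ, ← mul_assoc,
        mul_comm _ 2]
  refine le_antisymm (ciSup_le fun i => ?_) ?_
  · rw [← key i]
    exact dyadicDistrib_mono_nat hm _ (by omega)
  · rw [← key 0]
    exact le_ciSup (bddAbove_dyadicDistrib hm _) _

/-- A mass distribution on the dyadic tree whose masses tend to `0` uniformly as the level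
increases comes from a measure on `[0, ∞)`. -/
theorem exists_measure_of_dyadic_mass
    (hm : ∀ n k, m (n + 1) (2 * k) + m (n + 1) (2 * k + 1) = m n k)
    {u : ℕ → ℝ} (hu : Tendsto u atTop (𝓝 0)) (hmu : ∀ n k, (m n k : ℝ) ≤ u n) :
    ∃ μ : Measure ℝ≥0, μ {0} = 0 ∧ ∀ n i j : ℕ, i ≤ j →
      μ (Ioc (i / 2 ^ n) (j / 2 ^ n)) = ∑ k ∈ Finset.Ico i j, (m n k : ℝ≥0∞) := by
  let G : StieltjesFunction ℝ≥0 :=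
    { toFun := fun x => ⨆ n, dyadicDistrib m n x
      mono' := fun x y hxy => ciSup_mono (bddAbove_dyadicDistrib hm y) fun n =>
        sum_range_mono n (dyadicAddr_mono hxy n)
      right_continuous' := by
        intro x
        rw [Metric.continuousWithinAt_iff]
        intro ε hε
        -- A step of length less than `2 ^ (-n)` to the right enters at most one further cell, so
        -- the distribution function grows by at most two masses of level `n`.
        have hu2 : Tendsto (fun n => 2 * u n) atTop (𝓝 0) := by simpa using hu.const_mul 2
        obtain ⟨n, hn⟩ := (hu2.eventually (gt_mem_nhds hε)).exists
        refine ⟨(2 ^ n)⁻¹, by positivity, fun y (hy : x ≤ y) hxy => ?_⟩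
        have hle : ⨆ n, dyadicDistrib m n x ≤ ⨆ n, dyadicDistrib m n y :=
          ciSup_mono (bddAbove_dyadicDistrib hm y) fun n =>
            sum_range_mono n (dyadicAddr_mono hy n)
        rw [Real.dist_eq, abs_of_nonneg (sub_nonneg.2 hle)]
        have hy' : dyadicAddr y n + 1 ≤ dyadicAddr x n + 1 + 1 := by
          have hlt : (y : ℝ) * 2 ^ n < x * 2 ^ n + 1 := by
            rw [NNReal.dist_eq, abs_of_nonneg (by simpa using hy)] at hxy
            have h2 : (0 : ℝ) < 2 ^ n := by positivity
            have := mul_lt_mul_of_pos_right hxy h2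
            rw [inv_mul_cancel₀ h2.ne'] at this
            linarith
          have hlt' : y * 2 ^ n < x * 2 ^ n + 1 := by exact_mod_cast hlt
          have h3 : dyadicAddr y n ≤ ⌊x * 2 ^ n + 1⌋₊ := Nat.floor_mono hlt'.le
          rw [Nat.floor_add_one zero_le] at h3
          exact Nat.succ_le_succ h3
        have h1 : ⨆ n, dyadicDistrib m n y ≤
            ∑ k ∈ Finset.range (dyadicAddr x n + 1 + 1), (m n k : ℝ) :=
          ciSup_le fun i => (dyadicDistrib_le hm y i n).trans (sum_range_mono n hy')
        have h2 : dyadicDistrib m n x ≤ ⨆ n, dyadicDistrib m n x :=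
          le_ciSup (bddAbove_dyadicDistrib hm x) n
        rw [Finset.sum_range_succ, Finset.sum_range_succ] at h1
        rw [dyadicDistrib] at h2
        linarith [hmu n (dyadicAddr x n), hmu n (dyadicAddr x n + 1)] }
  have hG : ∀ n j : ℕ, G (j / 2 ^ n) = ∑ k ∈ Finset.range j, (m n k : ℝ) :=
    iSup_dyadicDistrib_natCast_div hm
  refine ⟨G.measure, ?_, fun n i j hij => ?_⟩
  · rw [← botSet_eq_singleton_of_isBot (x := (0 : ℝ≥0)) fun _ => zero_le]
    exact G.measure_botSet
  · rw [G.measure_Ioc, hG, hG, ← Finset.sum_Ico_eq_sub _ hij,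
      ENNReal.ofReal_sum_of_nonneg fun _ _ => by positivity]
    exact Finset.sum_congr rfl fun k _ => ENNReal.ofReal_coe_nnreal

end Stieltjes

/-! ### Dyadic content and Frostman's lemma -/

open TreeContent

/-- The weight `2 ^ (-n γ)` of a dyadic interval of length `2 ^ (-n)`. -/
noncomputable def dyadicWeight (γ : ℝ) (v : ℕ × ℕ) : ℝ≥0∞ := (((2⁻¹ ^ v.1 : ℝ≥0) ^ γ : ℝ≥0) : ℝ≥0∞)

lemma dyadicWeight_eq {γ : ℝ} (hγ : 0 ≤ γ) (v : ℕ × ℕ) :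
    dyadicWeight γ v = ((2⁻¹ ^ v.1 : ℝ≥0) : ℝ≥0∞) ^ γ :=
  (ENNReal.coe_rpow_of_nonneg _ hγ)

/-- The dyadic net content of exponent `γ`. -/
noncomputable abbrev dyadicContent (γ : ℝ) : Set ℝ≥0 → ℝ≥0∞ :=
  content dyadicAddr (dyadicWeight γ)

lemma dyadicWeight_le_cost {γ : ℝ} {V : Set (ℕ × ℕ)} {v : ℕ × ℕ} (hv : v ∈ V) :
    dyadicWeight γ v ≤ cost (dyadicWeight γ) V := by
  refine le_trans ?_ (ENNReal.le_tsum v)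
  simp [hv]

/-- A set of zero dyadic content has zero Hausdorff measure. -/
lemma hausdorffMeasure_eq_zero_of_dyadicContent {γ : ℝ} (hγ : 0 < γ) {E : Set ℝ≥0}
    (hE : dyadicContent γ E = 0) : μH[γ] E = 0 := by
  have hlim : Tendsto (fun j : ℕ => ((j : ℝ≥0∞))⁻¹) atTop (𝓝 0) :=
    ENNReal.tendsto_inv_nat_nhds_zero
  have hV : ∀ j : ℕ, ∃ V, E ⊆ cov dyadicAddr V ∧ cost (dyadicWeight γ) V < (j : ℝ≥0∞)⁻¹ :=
    fun j => exists_cover_of_content_lt (hE.trans_lt (by simp))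
  choose V hVE hVc using hV
  have hdiam : ∀ v : ℕ × ℕ, Metric.ediam {x | dyadicAddr x v.1 = v.2} ≤ ((2⁻¹ ^ v.1 : ℝ≥0) : ℝ≥0∞) :=
    fun v => Metric.ediam_le fun x hx y hy => edist_le_of_dyadicAddr_eq hx hy
  have key := Measure.hausdorffMeasure_le_liminf_tsum (ι := fun j => V j) γ E (l := atTop)
    (fun j : ℕ => ((j : ℝ≥0∞)⁻¹) ^ γ⁻¹)
    (by simpa [hγ] using hlim.ennrpow_const γ⁻¹)
    (fun j v => {x | dyadicAddr x v.1.1 = v.1.2})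
    -- A cover of small total cost has no heavy node, hence no long interval: its mesh tends to `0`
    -- automatically.
    (Eventually.of_forall fun j v => by
      refine (hdiam v).trans ?_
      rw [ENNReal.le_rpow_inv_iff hγ, ← dyadicWeight_eq hγ.le]
      exact (dyadicWeight_le_cost v.2).trans (hVc j).le)
    (Eventually.of_forall fun j x hx => by
      obtain ⟨n, hn⟩ := hVE j hx
      exact mem_iUnion.2 ⟨⟨_, hn⟩, rfl⟩)
  refine le_antisymm (key.trans ?_) zero_le
  rw [← hlim.liminf_eq]
  refine liminf_le_liminf (Eventually.of_forall fun j => ?_)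
  calc ∑' v : V j, Metric.ediam {x | dyadicAddr x v.1.1 = v.1.2} ^ γ
      ≤ ∑' v : V j, dyadicWeight γ v := ENNReal.tsum_le_tsum fun v => by
        rw [dyadicWeight_eq hγ.le]
        exact ENNReal.rpow_le_rpow (hdiam v) hγ.le
    _ = cost (dyadicWeight γ) (V j) := tsum_subtype _ _
    _ ≤ _ := (hVc j).le

/-- A set of zero dyadic content has open neighbourhoods of small content. -/
lemma exists_isOpen_dyadicContent_le {γ : ℝ} {K : Set ℝ≥0} (hK : dyadicContent γ K = 0)
    {c : ℝ≥0∞} (hc : c ≠ 0) : ∃ U, IsOpen U ∧ K ⊆ U ∧ dyadicContent γ U ≤ c := by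
  obtain ⟨V, hKV, hVc⟩ : ∃ V, K ⊆ cov dyadicAddr V ∧ cost (dyadicWeight γ) V < c / 2 :=
    exists_cover_of_content_lt (hK.trans_lt (ENNReal.half_pos hc))
  -- Each interval is opened up by adding its left neighbour, a node of equal weight. This at most
  -- doubles the cost, whence `c / 2` above.
  refine ⟨⋃ v ∈ V, {x : ℝ≥0 | (v.2 : ℝ≥0) < x * 2 ^ v.1 + 1 ∧ x * 2 ^ v.1 < v.2 + 1},
    isOpen_biUnion fun v _ => ?_, fun x hx => ?_, ?_⟩
  · exact (isOpen_lt (by fun_prop) (by fun_prop)).inter (isOpen_lt (by fun_prop) (by fun_prop))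
  · obtain ⟨n, hn⟩ := hKV hx
    obtain ⟨h1, h2⟩ := dyadicAddr_eq_iff.1 (rfl : dyadicAddr x n = _)
    exact mem_iUnion₂.2 ⟨_, hn, h1.trans_lt (lt_add_one _), h2⟩
  · set W : Set (ℕ × ℕ) := {v | (v.1, v.2 + 1) ∈ V} with hW
    have hWc : cost (dyadicWeight γ) W ≤ cost (dyadicWeight γ) V := by
      have hinj : Function.Injective fun v : ℕ × ℕ => (v.1, v.2 + 1) := by
        rintro ⟨n, k⟩ ⟨n', k'⟩ h
        simpa using h
      exact ENNReal.tsum_comp_le_tsum_of_injective hinj (V.indicator (dyadicWeight γ))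
    refine (content_le_cost (V := V ∪ W) fun x hx => ?_).trans ((cost_union_le V W).trans ?_)
    · obtain ⟨⟨n, k⟩, hv, h1, h2⟩ := mem_iUnion₂.1 hx
      simp only at h1 h2
      rcases le_or_gt (k : ℝ≥0) (x * 2 ^ n) with h | h
      · exact ⟨n, Or.inl (by rwa [dyadicAddr_eq_iff.2 ⟨h, h2⟩])⟩
      · cases k with
        | zero => simp at h
        | succ j =>
          push_cast at h h1
          have : dyadicAddr x n = j := dyadicAddr_eq_iff.2 ⟨(lt_of_add_lt_add_right h1).le, h⟩
          exact ⟨n, Or.inr (by rwa [this])⟩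
    · calc _ ≤ c / 2 + c / 2 := add_le_add hVc.le (hWc.trans hVc.le)
        _ = c := ENNReal.add_halves c

/-- Four cells cover the ball. Two are needed on the left because `Ioc` omits its left endpoint; `y
= 0` is excluded because the subtraction truncates at `0`. -/
lemma mem_Ioc_of_dist_le {x y : ℝ≥0} {n : ℕ} (h : dist y x ≤ (2 ^ n)⁻¹) (hy : y ≠ 0) :
    y ∈ Ioc (((dyadicAddr x n - 2 : ℕ) : ℝ≥0) / 2 ^ n) (((dyadicAddr x n + 2 : ℕ) : ℝ≥0) / 2 ^ n) := by
  obtain ⟨h1, h2⟩ := dyadicAddr_eq_iff.1 (rfl : dyadicAddr x n = _)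
  set k := dyadicAddr x n
  have hp : (0 : ℝ) < 2 ^ n := by positivity
  have h1' : (k : ℝ) ≤ x * 2 ^ n := by exact_mod_cast h1
  have h2' : (x : ℝ) * 2 ^ n < k + 1 := by exact_mod_cast h2
  rw [NNReal.dist_eq, abs_le] at h
  have h3 := mul_le_mul_of_nonneg_right h.1 hp.le
  have h4 := mul_le_mul_of_nonneg_right h.2 hp.le
  rw [neg_mul, inv_mul_cancel₀ hp.ne'] at h3
  rw [inv_mul_cancel₀ hp.ne'] at h4
  constructor
  · rw [div_lt_iff₀ (by positivity)]
    rcases lt_or_ge k 2 with hk | hk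
    · rw [Nat.sub_eq_zero_of_le hk.le, Nat.cast_zero]
      exact mul_pos (pos_iff_ne_zero.2 hy) (by positivity)
    · rw [← NNReal.coe_lt_coe]
      rw [NNReal.coe_natCast, Nat.cast_sub hk]
      push_cast
      linarith
  · rw [le_div_iff₀ (by positivity), ← NNReal.coe_le_coe]
    push_cast
    linarith

/-- Frostman's lemma for a closed set. -/
lemma exists_frostman_measure_of_isClosed {γ : ℝ} (hγ : 0 < γ) {K : Set ℝ≥0} (hK : IsClosed K)
    (hK1 : K ⊆ Icc 0 1) (hKc : dyadicContent γ K ≠ 0) :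
    ∃ μ : Measure ℝ≥0, IsFiniteMeasure μ ∧ μ ≠ 0 ∧ μ Kᶜ = 0 ∧
      ∀ x : ℝ≥0, ∀ r : ℝ≥0, 0 < r → r ≤ 1 →
        μ {y | edist x y ≤ r} ≤ (4 * 2 ^ γ : ℝ≥0) * (r : ℝ≥0∞) ^ γ := by
  have hfw : ∀ n k, dyadicContent γ (K ∩ {x | dyadicAddr x n = k}) ≤ dyadicWeight γ (n, k) :=
    fun n k => content_le_weight fun x hx => hx.2
  have hfin : ∀ n k, dyadicContent γ (K ∩ {x | dyadicAddr x n = k}) ≠ ∞ := fun n k =>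
    ((hfw n k).trans_lt ENNReal.coe_lt_top).ne
  set f : ℕ → ℕ → ℝ≥0 :=
    fun n k => (dyadicContent γ (K ∩ {x | dyadicAddr x n = k})).toNNReal with hfdef
  have hf_coe : ∀ n k, (f n k : ℝ≥0∞) = dyadicContent γ (K ∩ {x | dyadicAddr x n = k}) :=
    fun n k => ENNReal.coe_toNNReal (hfin n k)
  have hf : ∀ n k, f n k ≤ f (n + 1) (2 * k) + f (n + 1) (2 * k + 1) := by
    intro n k
    rw [← ENNReal.coe_le_coe, ENNReal.coe_add, hf_coe, hf_coe, hf_coe]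
    refine (content_mono ?_).trans (content_union_le _ _)
    rintro x ⟨hxK, hx⟩
    rw [← inter_union_distrib_left]
    refine ⟨hxK, ?_⟩
    simp only [mem_ofPred_eq, mem_union] at hx ⊢
    have := dyadicAddr_succ_div_two x n
    omega
  have hfle : ∀ n k, f n k ≤ (2⁻¹ ^ n : ℝ≥0) ^ γ := fun n k => by
    rw [← ENNReal.coe_le_coe, hf_coe]
    exact hfw n k
  have hmle := splitMass_le hf
  have hu : Tendsto (fun n : ℕ => (((2⁻¹ ^ n : ℝ≥0) ^ γ : ℝ≥0) : ℝ)) atTop (𝓝 0) := by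
    have h1 : Tendsto (fun n : ℕ => (2⁻¹ ^ n : ℝ≥0)) atTop (𝓝 0) :=
      tendsto_pow_atTop_nhds_zero_of_lt_one zero_le (by norm_num)
    have h2 := ((NNReal.continuousAt_rpow_const (y := γ) (Or.inr hγ.le)).tendsto.comp h1)
    rw [NNReal.zero_rpow hγ.ne'] at h2
    exact NNReal.tendsto_coe.2 h2
  obtain ⟨μ, hμ0, hμ⟩ := exists_measure_of_dyadic_mass (splitMass_add hf) hu
    fun n k => NNReal.coe_le_coe.2 ((hmle n k).trans (hfle n k))
  have hball : ∀ (x : ℝ≥0) (n : ℕ), μ (Metric.closedBall x (2 ^ n)⁻¹) ≤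
      ∑ k ∈ Finset.Ico (dyadicAddr x n - 2) (dyadicAddr x n + 2), (splitMass f n k : ℝ≥0∞) := by
    intro x n
    rw [← hμ n _ _ (by omega)]
    refine (measure_mono (t := {0} ∪ Ioc _ _) fun y hy => ?_).trans
      ((measure_union_le _ _).trans (by rw [hμ0, zero_add]))
    rcases eq_or_ne y 0 with h | h
    · exact Or.inl h
    · exact Or.inr (mem_Ioc_of_dist_le hy h)
  -- The root cells `0` and `1` are both needed, as the point `1` has address `1` at level `0`.
  -- There the split mass is the content itself, so it cannot vanish on both cells.
  refine ⟨μ.restrict (Ioc 0 2), ⟨?_⟩, ?_, ?_, fun x r hr hr1 => ?_⟩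
  · have h := hμ 0 0 2 (by norm_num)
    simp only [Nat.cast_zero, Nat.cast_ofNat, pow_zero, div_one] at h
    rw [Measure.restrict_apply_univ, h]
    exact ENNReal.sum_lt_top.2 fun _ _ => ENNReal.coe_lt_top
  · rw [Ne, Measure.restrict_eq_zero]
    have h := hμ 0 0 2 (by norm_num)
    simp only [Nat.cast_zero, Nat.cast_ofNat, pow_zero, div_one] at h
    rw [h]
    simp only [splitMass, hf_coe, Finset.sum_eq_zero_iff, not_forall]
    by_contra! h0
    refine hKc (le_antisymm ?_ zero_le)
    calc dyadicContent γ K ≤ dyadicContent γ ((K ∩ {x | dyadicAddr x 0 = 0}) ∪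
          (K ∩ {x | dyadicAddr x 0 = 1})) := content_mono fun x hx => by
            rw [← inter_union_distrib_left]
            refine ⟨hx, ?_⟩
            have h1 : dyadicAddr x 0 ≤ 1 := by
              have := Nat.floor_mono (hK1 hx).2
              simpa [dyadicAddr] using this
            simp only [mem_ofPred_eq, mem_union]
            omega
      _ ≤ _ := content_union_le _ _
      _ = 0 + 0 := congrArg₂ _ (h0 0 (by simp)) (h0 1 (by simp))
      _ = 0 := add_zero 0
  · refine le_antisymm ((Measure.restrict_apply_le _ _).trans ?_) zero_le
    refine le_of_eq (measure_null_of_locally_null _ fun x hx => ?_)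
    obtain ⟨ε, hε, hεK⟩ := Metric.isOpen_iff.1 hK.isOpen_compl x hx
    -- Every point of the four cells used in `hball` is within `3 * 2 ^ (-n)` of `x`. For large `n`
    -- these cells miss `K` and carry no mass.
    have hlim : Tendsto (fun n : ℕ => 3 * (2⁻¹ : ℝ) ^ n) atTop (𝓝 0) := by
      simpa using (tendsto_pow_atTop_nhds_zero_of_lt_one (r := (2⁻¹ : ℝ)) (by norm_num)
        (by norm_num)).const_mul 3
    obtain ⟨n, hn⟩ := (hlim.eventually (gt_mem_nhds hε)).exists
    refine ⟨_, mem_nhdsWithin_of_mem_nhds (Metric.closedBall_mem_nhds x (ε := (2 ^ n)⁻¹)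
      (by positivity)), le_antisymm ((hball x n).trans (le_of_eq ?_)) zero_le⟩
    refine Finset.sum_eq_zero fun k hk => ?_
    have hf0 : f n k = 0 := by
      have : K ∩ {y | dyadicAddr y n = k} = ∅ := by
        refine eq_empty_of_forall_notMem fun y hy => hεK (?_ : y ∈ Metric.ball x ε) hy.1
        obtain ⟨h1, h2⟩ := dyadicAddr_eq_iff.1 (rfl : dyadicAddr x n = _)
        obtain ⟨h3, h4⟩ := dyadicAddr_eq_iff.1 hy.2
        obtain ⟨h5, h6⟩ := Finset.mem_Ico.1 hk
        set j := dyadicAddr x n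
        have h5' : (j : ℝ) ≤ k + 2 := by exact_mod_cast (by omega : j ≤ k + 2)
        have h6' : (k : ℝ) + 1 ≤ j + 2 := by exact_mod_cast (by omega : k + 1 ≤ j + 2)
        have h1' : (j : ℝ) ≤ x * 2 ^ n := by exact_mod_cast h1
        have h2' : (x : ℝ) * 2 ^ n < j + 1 := by exact_mod_cast h2
        have h3' : (k : ℝ) ≤ y * 2 ^ n := by exact_mod_cast h3
        have h4' : (y : ℝ) * 2 ^ n < k + 1 := by exact_mod_cast h4
        have hp : (0 : ℝ) < 2 ^ n := by positivity
        rw [Metric.mem_ball, NNReal.dist_eq]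
        refine lt_of_le_of_lt ?_ hn
        rw [inv_pow, ← div_eq_mul_inv, le_div_iff₀ hp, ← abs_of_pos hp, ← abs_mul, abs_le]
        constructor <;> nlinarith
      simp only [hfdef, this, dyadicContent, content_empty, ENNReal.toNNReal_zero]
    have := hmle n k
    rw [hf0] at this
    rw [le_antisymm this zero_le, ENNReal.coe_zero]
  -- With `2 ^ (-(n + 1)) < r ≤ 2 ^ (-n)`, the four cells have length at most `2 * r`, which gives
  -- the constant `4 * 2 ^ γ`.
  · obtain ⟨n, hn1, hn2⟩ := exists_nat_pow_near_of_lt_one hr hr1 (y := (2⁻¹ : ℝ≥0)) (by norm_num)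
      (by norm_num)
    refine (Measure.restrict_apply_le _ _).trans ?_
    calc μ {y | edist x y ≤ r} ≤ μ (Metric.closedBall x (2 ^ n)⁻¹) := by
          refine measure_mono fun y hy => ?_
          rw [mem_ofPred_eq, edist_comm, edist_nndist, ENNReal.coe_le_coe] at hy
          have := hy.trans hn2
          rw [Metric.mem_closedBall, ← coe_nndist, ← inv_pow]
          exact_mod_cast this
      _ ≤ _ := hball x n
      _ ≤ ∑ k ∈ Finset.Ico (dyadicAddr x n - 2) (dyadicAddr x n + 2),
          (((2⁻¹ ^ n : ℝ≥0) ^ γ : ℝ≥0) : ℝ≥0∞) := Finset.sum_le_sum fun k _ =>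
            ENNReal.coe_le_coe.2 ((hmle n k).trans (hfle n k))
      _ ≤ 4 * (((2⁻¹ ^ n : ℝ≥0) ^ γ : ℝ≥0) : ℝ≥0∞) := by
          rw [Finset.sum_const, nsmul_eq_mul, Nat.card_Ico]
          gcongr
          exact_mod_cast (by omega : dyadicAddr x n + 2 - (dyadicAddr x n - 2) ≤ 4)
      _ ≤ 4 * (((2 * r) ^ γ : ℝ≥0) : ℝ≥0∞) := by
          gcongr
          rw [pow_succ, ← div_eq_mul_inv, div_lt_iff₀ (by norm_num), mul_comm] at hn1
          exact hn1.le
      _ = _ := by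
          rw [← ENNReal.coe_rpow_of_nonneg _ hγ.le, NNReal.mul_rpow]
          push_cast
          ring

/-- **Frostman's lemma** for analytic subsets of the unit interval. -/
theorem exists_frostman_measure {E : Set ℝ≥0} (hE : AnalyticSet E) (hE1 : E ⊆ Icc 0 1) {γ : ℝ≥0}
    (hγ : 0 < γ) (hdim : (γ : ℝ≥0∞) < dimH E) :
    ∃ μ : Measure ℝ≥0, IsFiniteMeasure μ ∧ μ ≠ 0 ∧ μ Eᶜ = 0 ∧ ∃ C : ℝ≥0,
      ∀ x : ℝ≥0, ∀ r : ℝ≥0, 0 < r → r ≤ 1 →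
        μ {y | edist x y ≤ r} ≤ C * (r : ℝ≥0∞) ^ (γ : ℝ) := by
  have hγ' : (0 : ℝ) < γ := hγ
  have hpos : dyadicContent γ E ≠ 0 := fun h => by
    have h1 := hausdorffMeasure_of_lt_dimH hdim
    rw [hausdorffMeasure_eq_zero_of_dyadicContent hγ' h] at h1
    exact ENNReal.zero_ne_top h1
  rw [AnalyticSet] at hE
  rcases hE with rfl | ⟨g, hg, rfl⟩
  · exact absurd content_empty hpos
  obtain ⟨c, hc0, hc⟩ := exists_between (pos_iff_ne_zero.2 hpos)
  obtain ⟨K, hKE, hKcomp, hK⟩ := exists_isCompact_forall_isOpen_lt (Φ := dyadicContent γ)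
    (fun _ _ h => content_mono h)
    (fun _ hA _ hL => content_iUnion_le dyadicAddr_coherent hA hL) hg hc
  have hKpos : dyadicContent γ K ≠ 0 := fun h => by
    obtain ⟨U, hU, hKU, hUc⟩ := exists_isOpen_dyadicContent_le h hc0.ne'
    exact (hK U hU hKU).not_ge hUc
  obtain ⟨μ, hfin, h0, hKc, hgrowth⟩ :=
    exists_frostman_measure_of_isClosed hγ' hKcomp.isClosed (hKE.trans hE1) hKpos
  exact ⟨μ, hfin, h0, measure_mono_null (compl_subset_compl.2 hKE) hKc, _, hgrowth⟩

/-! ### Negative moments and the energy method -/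

/-- The constant `∑ₙ (2 ^ (-(n + 1))) ^ (-b) (2 ^ (-n)) ^ a` of the layer cake estimate
`lintegral_rpow_neg_le`. -/
noncomputable def layerConst (a b : ℝ) : ℝ≥0∞ :=
  ∑' n : ℕ, ((2⁻¹ ^ (n + 1) : ℝ≥0) : ℝ≥0∞) ^ (-b) * ((2⁻¹ ^ n : ℝ≥0) : ℝ≥0∞) ^ a

lemma layerConst_ne_top {a b : ℝ} (hab : b < a) : layerConst a b ≠ ∞ := by
  have hterm : ∀ n : ℕ, ((2⁻¹ ^ (n + 1) : ℝ≥0) : ℝ≥0∞) ^ (-b) * ((2⁻¹ ^ n : ℝ≥0) : ℝ≥0∞) ^ a =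
      ((2⁻¹ ^ (-b) * (2⁻¹ ^ (a - b)) ^ n : ℝ≥0) : ℝ≥0∞) := by
    intro n
    have h0 : ((2⁻¹ : ℝ≥0) ^ n) ≠ 0 := by positivity
    have h1 : ((2⁻¹ : ℝ≥0) ^ (n + 1)) ≠ 0 := by positivity
    rw [← ENNReal.coe_rpow_of_ne_zero h0, ← ENNReal.coe_rpow_of_ne_zero h1, ← ENNReal.coe_mul]
    congr 1
    rw [pow_succ, NNReal.mul_rpow, ← NNReal.rpow_natCast (2⁻¹ ^ (a - b)), ← NNReal.rpow_mul,
      mul_comm (a - b), NNReal.rpow_mul, NNReal.rpow_natCast, mul_right_comm,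
      ← NNReal.rpow_add h0, mul_comm, neg_add_eq_sub]
  rw [layerConst, tsum_congr hterm]
  refine ENNReal.tsum_coe_ne_top_iff_summable.2 (Summable.mul_left _ ?_)
  refine NNReal.summable_geometric (NNReal.rpow_lt_one ?_ (sub_pos.2 hab))
  norm_num

/-- Layer cake estimate of a negative moment from a small ball estimate. -/
lemma lintegral_rpow_neg_le {Ω : Type*} [MeasurableSpace Ω] (ν : Measure Ω) {D : Ω → ℝ≥0∞}
    (hD : Measurable D) {a b : ℝ} (hb : 0 < b) {C : ℝ≥0∞} {ρ : ℝ≥0} (hρ : 0 < ρ)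
    (h : ∀ r : ℝ≥0, 0 < r → r ≤ ρ → ν {ω | D ω ≤ r} ≤ C * (r : ℝ≥0∞) ^ a) :
    ∫⁻ ω, D ω ^ (-b) ∂ν ≤
      (ρ : ℝ≥0∞) ^ (-b) * ν univ + layerConst a b * C * (ρ : ℝ≥0∞) ^ (a - b) := by
  have hρ0 : (ρ : ℝ≥0∞) ≠ 0 := by simpa using hρ.ne'
  have hanti : ∀ {x y : ℝ≥0∞}, x ≤ y → y ^ (-b) ≤ x ^ (-b) := fun hxy => by
    rw [ENNReal.rpow_neg, ENNReal.rpow_neg, ENNReal.inv_le_inv]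
    exact ENNReal.rpow_le_rpow hxy hb.le
  set q : ℕ → ℝ≥0 := fun n => ρ * 2⁻¹ ^ n with hq
  have hqpos : ∀ n, 0 < q n := fun n => by positivity
  have hqle : ∀ n, q n ≤ ρ := fun n =>
    mul_le_of_le_one_right zero_le (pow_le_one₀ zero_le (by norm_num))
  -- If `q (n + 1) < D ω ≤ q n`, the `n`-th term alone dominates. If `D ω = 0`, all terms are
  -- present and bounded below, so the series is infinite.
  have hpt : ∀ ω, D ω ^ (-b) ≤ (ρ : ℝ≥0∞) ^ (-b) +
      ∑' n, {ω | D ω ≤ q n}.indicator (fun _ => (q (n + 1) : ℝ≥0∞) ^ (-b)) ω := by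
    intro ω
    rcases le_total (ρ : ℝ≥0∞) (D ω) with hρD | hDρ
    · exact (hanti hρD).trans le_self_add
    · refine le_trans ?_ le_add_self
      rcases eq_or_ne (D ω) 0 with h0 | h0
      · refine le_top.trans ?_
        rw [← ENNReal.tsum_const_eq_top_of_ne_zero (α := ℕ) (c := (ρ : ℝ≥0∞) ^ (-b))
          (by rw [ENNReal.rpow_neg]; simp [hb.le])]
        refine ENNReal.tsum_le_tsum fun n => ?_
        rw [indicator_of_mem (by simp [h0])]
        exact hanti (ENNReal.coe_le_coe.2 (hqle _))
      · lift D ω to ℝ≥0 using ne_top_of_le_ne_top ENNReal.coe_ne_top hDρ with x hx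
        have hx0 : 0 < x := pos_iff_ne_zero.2 (by simpa using h0)
        obtain ⟨n, hn1, hn2⟩ := exists_nat_pow_near_of_lt_one (x := x / ρ) (y := (2⁻¹ : ℝ≥0))
          (by positivity) (div_le_one_of_le₀ (by exact_mod_cast hDρ) zero_le) (by norm_num)
          (by norm_num)
        rw [lt_div_iff₀' hρ] at hn1
        rw [div_le_iff₀' hρ] at hn2
        refine le_trans ?_ (ENNReal.le_tsum n)
        rw [indicator_of_mem (by rw [mem_ofPred_eq, ← hx]; exact_mod_cast hn2)]
        exact hanti (ENNReal.coe_le_coe.2 hn1.le)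
  have hms : ∀ n, MeasurableSet {ω | D ω ≤ q n} := fun n => measurableSet_le hD measurable_const
  calc ∫⁻ ω, D ω ^ (-b) ∂ν ≤ ∫⁻ ω, ((ρ : ℝ≥0∞) ^ (-b) +
      ∑' n, {ω | D ω ≤ q n}.indicator (fun _ => (q (n + 1) : ℝ≥0∞) ^ (-b)) ω) ∂ν :=
        lintegral_mono hpt
    _ = (ρ : ℝ≥0∞) ^ (-b) * ν univ + ∑' n, (q (n + 1) : ℝ≥0∞) ^ (-b) * ν {ω | D ω ≤ q n} := by
        rw [lintegral_add_left measurable_const, lintegral_const, lintegral_tsum fun n =>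
          (measurable_const.indicator (hms n)).aemeasurable]
        congr 1
        exact tsum_congr fun n => lintegral_indicator_const (hms n) _
    _ ≤ (ρ : ℝ≥0∞) ^ (-b) * ν univ +
        ∑' n, (q (n + 1) : ℝ≥0∞) ^ (-b) * (C * (q n : ℝ≥0∞) ^ a) := by
        gcongr with n
        exact h _ (hqpos n) (hqle n)
    _ = _ := by
        congr 1
        rw [layerConst, ← ENNReal.tsum_mul_right, ← ENNReal.tsum_mul_right]
        refine tsum_congr fun n => ?_
        simp only [hq, ENNReal.coe_mul]
        rw [ENNReal.mul_rpow_of_ne_top ENNReal.coe_ne_top ENNReal.coe_ne_top,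
          ENNReal.mul_rpow_of_ne_top ENNReal.coe_ne_top ENNReal.coe_ne_top, sub_eq_add_neg,
          ENNReal.rpow_add _ _ hρ0 ENNReal.coe_ne_top]
        ring

/-- The energy method: a set carrying a measure whose image under `Y` has finite `b`-energy has
an image of Hausdorff dimension at least `b`. -/
theorem le_dimH_image_of_energy_ne_top {T S : Type*} [MeasurableSpace T] [EMetricSpace S]
    [SecondCountableTopology S] [MeasurableSpace S] [BorelSpace S] {Y : T → S} (hY : Measurable Y)
    {μ : Measure T} [IsFiniteMeasure μ] (hμ : μ ≠ 0) {E : Set T} (hE : μ Eᶜ = 0) {b : ℝ≥0}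
    (h : ∫⁻ s, ∫⁻ t, edist (Y s) (Y t) ^ (-(b : ℝ)) ∂μ ∂μ ≠ ∞) : (b : ℝ≥0∞) ≤ dimH (Y '' E) := by
  have hmeas : Measurable fun p : T × T => edist (Y p.1) (Y p.2) ^ (-(b : ℝ)) :=
    ((hY.comp measurable_fst).edist (hY.comp measurable_snd)).pow_const _
  set φ : T → ℝ≥0∞ := fun s => ∫⁻ t, edist (Y s) (Y t) ^ (-(b : ℝ)) ∂μ with hφ
  have hφm : Measurable φ := hmeas.lintegral_prod_right'
  have hfin : ∀ᵐ s ∂μ, φ s < ∞ := ae_lt_top hφm h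
  obtain ⟨M, hM⟩ : ∃ M : ℕ, μ {s | φ s ≤ (M + 1 : ℕ)} ≠ 0 := by
    by_contra! h0
    have hall : ∀ᵐ s ∂μ, ∀ M : ℕ, ¬ φ s ≤ (M + 1 : ℕ) :=
      ae_all_iff.2 fun M => measure_eq_zero_iff_ae_notMem.1 (h0 M)
    have hfalse : ∀ᵐ s ∂μ, False := by
      filter_upwards [hfin, hall] with s hs1 hs2
      obtain ⟨n, hn⟩ := ENNReal.exists_nat_gt hs1.ne
      exact hs2 n (hn.le.trans (by exact_mod_cast n.le_succ))
    rw [ae_iff] at hfalse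
    exact hμ (Measure.measure_univ_eq_zero.1 (by simpa using hfalse))
  set A : Set T := {s | φ s ≤ (M + 1 : ℕ)} with hA
  have hAm : MeasurableSet A := measurableSet_le hφm measurable_const
  have hM0 : ((M + 1 : ℕ) : ℝ≥0∞) ≠ 0 := by exact_mod_cast M.succ_ne_zero
  have hMt : ((M + 1 : ℕ) : ℝ≥0∞) ≠ ∞ := ENNReal.natCast_ne_top _
  set ν : Measure S := (μ.restrict A).map Y with hν
  -- Mass distribution principle: if `Y s₀ ∈ s` with `s₀ ∈ A`, all of `s` is within its diameter of
  -- `Y s₀`, and the potential at `s₀` is at most `M + 1`. Closed sets suffice since closure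
  -- preserves the diameter.
  have hclosed : ∀ s : Set S, IsClosed s → ν s ≤ (M + 1 : ℕ) * Metric.ediam s ^ (b : ℝ) := by
    intro s hs
    rw [hν, Measure.map_apply hY hs.measurableSet, Measure.restrict_apply (hY hs.measurableSet)]
    rcases (Y ⁻¹' s ∩ A).eq_empty_or_nonempty with he | ⟨s₀, hs₀, hs₀A⟩
    · simp [he]
    · refine (measure_mono inter_subset_left).trans ?_
      rw [← ENNReal.div_le_iff_le_mul (Or.inr hMt) (Or.inr hM0)]
      refine le_trans ?_ hs₀A
      calc μ (Y ⁻¹' s) / Metric.ediam s ^ (b : ℝ)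
          = ∫⁻ t in Y ⁻¹' s, Metric.ediam s ^ (-(b : ℝ)) ∂μ := by
            rw [setLIntegral_const, ENNReal.rpow_neg, div_eq_mul_inv, mul_comm]
        _ ≤ ∫⁻ t in Y ⁻¹' s, edist (Y s₀) (Y t) ^ (-(b : ℝ)) ∂μ := by
            refine setLIntegral_mono' (hY hs.measurableSet) fun t ht => ?_
            rw [ENNReal.rpow_neg, ENNReal.rpow_neg, ENNReal.inv_le_inv]
            exact ENNReal.rpow_le_rpow (Metric.edist_le_ediam_of_mem hs₀ ht) b.2
        _ ≤ φ s₀ := setLIntegral_le_lintegral _ _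
  have hle : ((M + 1 : ℕ) : ℝ≥0∞)⁻¹ • ν ≤ μH[b] := by
    refine Measure.le_hausdorffMeasure _ _ 1 one_pos fun s _ => ?_
    rw [Measure.smul_apply, smul_eq_mul, ← Metric.ediam_closure]
    refine (mul_le_mul_right (measure_mono subset_closure) _).trans ?_
    rw [mul_comm, ← div_eq_mul_inv, ENNReal.div_le_iff_le_mul (Or.inl hM0) (Or.inl hMt), mul_comm]
    exact hclosed _ isClosed_closure
  refine le_dimH_of_hausdorffMeasure_ne_zero (ne_of_gt (lt_of_lt_of_le ?_ (hle (Y '' E))))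
  rw [Measure.smul_apply, smul_eq_mul]
  refine ENNReal.mul_pos (ENNReal.inv_ne_zero.2 hMt) (ne_of_gt ?_)
  -- Neither `E` nor its image need be measurable: only outer measure inequalities and the
  -- measurability of `A` enter.
  calc 0 < μ A := pos_iff_ne_zero.2 hM
    _ ≤ μ (E ∩ A) + μ Eᶜ := (measure_mono fun x hx => by
        by_cases hxE : x ∈ E
        · exact Or.inl ⟨hxE, hx⟩
        · exact Or.inr hxE).trans (measure_union_le _ _)
    _ = (μ.restrict A) E := by rw [hE, add_zero, Measure.restrict_apply' hAm]
    _ ≤ (μ.restrict A) (Y ⁻¹' (Y '' E)) := measure_mono (subset_preimage_image _ _)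
    _ ≤ ν (Y '' E) := Measure.le_map_apply hY.aemeasurable _

/-! ### Joint measurability -/

/-- A process with almost surely right-continuous paths is almost surely equal to a jointly
measurable one. -/
lemma exists_measurable_uncurry_of_ae_rightContinuous {Ω S : Type*} [MeasurableSpace Ω]
    [TopologicalSpace S] [TopologicalSpace.PseudoMetrizableSpace S] [MeasurableSpace S]
    [BorelSpace S] [Nonempty S] {μ : Measure Ω} {X : ℝ≥0 → Ω → S} (hX : ∀ t, Measurable (X t))
    (hrc : ∀ᵐ ω ∂μ, ∀ t, ContinuousWithinAt (fun s => X s ω) (Ici t) t) :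
    ∃ Y : ℝ≥0 → Ω → S, Measurable (Function.uncurry Y) ∧ ∀ᵐ ω ∂μ, ∀ t, Y t ω = X t ω := by
  classical
  obtain ⟨z⟩ := ‹Nonempty S›
  set N := toMeasurable μ {ω | ¬ ∀ t, ContinuousWithinAt (fun s => X s ω) (Ici t) t} with hN
  have hNm : MeasurableSet N := measurableSet_toMeasurable _ _
  have hN0 : μ N = 0 := by rw [hN, measure_toMeasurable]; exact hrc
  have hNc : ∀ ω ∉ N, ∀ t, ContinuousWithinAt (fun s => X s ω) (Ici t) t := fun ω hω => by
    by_contra h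
    exact hω (subset_toMeasurable _ _ h)
  refine ⟨fun t ω => if ω ∈ N then z else X t ω, ?_, ?_⟩
  -- Sampling at the right endpoint of the dyadic cell of `t` makes the times approach `t` from the
  -- right.
  · let Z : ℕ → ℝ≥0 × Ω → S := fun n p =>
      if p.2 ∈ N then z else X ((dyadicAddr p.1 n + 1) / 2 ^ n) p.2
    have hZ : ∀ n, Measurable (Z n) := by
      intro n
      refine Measurable.ite (measurable_snd hNm) measurable_const ?_
      have h1 : Measurable fun q : ℕ × Ω => X ((q.1 + 1) / 2 ^ n) q.2 :=
        measurable_from_prod_countable_right fun k => hX ((k + 1) / 2 ^ n)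
      have h2 : Measurable fun p : ℝ≥0 × Ω => (dyadicAddr p.1 n, p.2) :=
        (Nat.measurable_floor.comp (measurable_fst.mul_const _)).prodMk measurable_snd
      simpa only [Function.comp_def] using h1.comp h2
    refine measurable_of_tendsto_metrizable hZ (tendsto_pi_nhds.2 fun p => ?_)
    obtain ⟨t, ω⟩ := p
    by_cases hω : ω ∈ N
    · simpa [Z, Function.uncurry, hω] using tendsto_const_nhds
    · simp only [Z, Function.uncurry, hω, if_false]
      have hlim : Tendsto (fun n : ℕ => ((dyadicAddr t n + 1) / 2 ^ n : ℝ≥0)) atTop (𝓝[≥] t) := by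
        refine tendsto_nhdsWithin_iff.2 ⟨?_, Eventually.of_forall fun n => ?_⟩
        · refine tendsto_of_tendsto_of_tendsto_of_le_of_le (g := fun _ => t)
            (h := fun n : ℕ => t + 2⁻¹ ^ n) tendsto_const_nhds ?_ (fun n => ?_) fun n => ?_
          · simpa using (tendsto_const_nhds (x := t)).add
              (tendsto_pow_atTop_nhds_zero_of_lt_one (r := (2⁻¹ : ℝ≥0)) zero_le (by norm_num))
          · rw [le_div_iff₀ (by positivity)]
            exact (Nat.lt_floor_add_one _).le
          · simp only
            rw [div_le_iff₀ (by positivity), add_mul, ← mul_pow, inv_mul_cancel₀ two_ne_zero,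
              one_pow]
            gcongr
            exact Nat.floor_le zero_le
        · rw [mem_Ici, le_div_iff₀ (by positivity)]
          exact (Nat.lt_floor_add_one _).le
      exact (hNc ω hω t).tendsto.comp hlim
  · filter_upwards [measure_eq_zero_iff_ae_notMem.1 hN0] with ω hω t
    simp [hω]

/-! ### Increments of the process and energy of the image -/

section Feller

variable {d : ℕ} {Ω : Type*} [MeasurableSpace Ω]
  {P : EuclideanSpace ℝ (Fin d) → Measure Ω} {X : ℝ≥0 → Ω → EuclideanSpace ℝ (Fin d)}
  {p : ℝ≥0 → EuclideanSpace ℝ (Fin d) → EuclideanSpace ℝ (Fin d) → ℝ}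

/-- The Markov property on rectangles, with a bounded transition density. -/
lemma measure_inter_preimage_le (hX : IsFellerProcess P X) (hp : IsTransitionDensity P X p)
    {t : ℝ≥0} (ht : 0 < t) {κ : ℝ} (hκ : ∀ x y, p t x y ≤ κ) (x : EuclideanSpace ℝ (Fin d))
    (s : ℝ≥0) {Q B : Set (EuclideanSpace ℝ (Fin d))} (hQ : MeasurableSet Q) (hB : MeasurableSet B)
    (hBfin : volume B ≠ ∞) :
    P x (X s ⁻¹' Q ∩ X (s + t) ⁻¹' B) ≤ ENNReal.ofReal κ * volume B * P x (X s ⁻¹' Q) := by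
  have := hX.isProbabilityMeasure
  set L : ℝ≥0∞ := ENNReal.ofReal κ * volume B with hL
  have hLt : L ≠ ∞ := ENNReal.mul_ne_top ENNReal.ofReal_ne_top hBfin
  have hlaw : ∀ y, (P y).real (X t ⁻¹' B) ≤ L.toReal := by
    intro y
    refine ENNReal.toReal_mono hLt ?_
    rw [hp.law t ht y B hB, hL, ← setLIntegral_const]
    exact lintegral_mono fun z => ENNReal.ofReal_le_ofReal (hκ y z)
  set ℱ := Filtration.natural X fun r => (hX.measurable r).stronglyMeasurable with hℱ
  have hQ' : MeasurableSet[ℱ s] (X s ⁻¹' Q) :=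
    (Filtration.stronglyAdapted_natural fun r => (hX.measurable r).stronglyMeasurable) s
      |>.measurable hQ
  have hBm : MeasurableSet (X (s + t) ⁻¹' B) := hX.measurable _ hB
  have hQm : MeasurableSet (X s ⁻¹' Q) := hX.measurable _ hQ
  have hint : Integrable ((X (s + t) ⁻¹' B).indicator fun _ => (1 : ℝ)) (P x) :=
    (integrable_const 1).indicator hBm
  have key : (P x).real (X s ⁻¹' Q ∩ X (s + t) ⁻¹' B) ≤ L.toReal * (P x).real (X s ⁻¹' Q) :=
    calc (P x).real (X s ⁻¹' Q ∩ X (s + t) ⁻¹' B)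
        = ∫ ω in X s ⁻¹' Q, (X (s + t) ⁻¹' B).indicator (fun _ => (1 : ℝ)) ω ∂(P x) := by
          rw [setIntegral_indicator hBm, setIntegral_const, smul_eq_mul, mul_one]
      _ = ∫ ω in X s ⁻¹' Q, ((P x)⟦X (s + t) ⁻¹' B | ℱ s⟧) ω ∂(P x) :=
          (setIntegral_condExp (ℱ.le s) hint hQ').symm
      _ ≤ ∫ ω in X s ⁻¹' Q, L.toReal ∂(P x) := by
          refine setIntegral_mono_ae integrable_condExp.integrableOn
            (integrable_const _).integrableOn ?_
          filter_upwards [hX.markov x s t B hB] with ω hω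
          rw [hω]
          exact hlaw _
      _ = _ := by rw [setIntegral_const, smul_eq_mul, mul_comm]
  rw [← ENNReal.toReal_le_toReal (measure_ne_top _ _) (ENNReal.mul_ne_top hLt (measure_ne_top _ _)),
    ENNReal.toReal_mul]
  exact key

/-- The volume of a ball of radius `2`. -/
noncomputable def volBallTwo (d : ℕ) : ℝ≥0∞ :=
  volume (Metric.closedBall (0 : EuclideanSpace ℝ (Fin d)) 2)

/-- Small ball estimate for the increments. -/
lemma measure_edist_increment_le (hX : IsFellerProcess P X) (hp : IsTransitionDensity P X p)
    {t : ℝ≥0} (ht : 0 < t) {κ : ℝ} (hκ : ∀ x y, p t x y ≤ κ) (x : EuclideanSpace ℝ (Fin d))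
    (s : ℝ≥0) {r : ℝ≥0} (hr : 0 < r) :
    P x {ω | edist (X s ω) (X (s + t) ω) ≤ r} ≤
      ENNReal.ofReal κ * volBallTwo d * (r : ℝ≥0∞) ^ (d : ℝ) := by
  have := hX.isProbabilityMeasure
  set z := TopologicalSpace.denseSeq (EuclideanSpace ℝ (Fin d)) with hz
  -- Localising `X s` in a cell of radius `r` turns a small increment into a visit to a fixed ball
  -- of radius `2 * r`. The cells are disjoint, so their probabilities sum to `1`.
  set Q : ℕ → Set (EuclideanSpace ℝ (Fin d)) := disjointed fun k => Metric.closedBall (z k) r with hQ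
  have hQm : ∀ k, MeasurableSet (Q k) :=
    fun k => MeasurableSet.disjointed (fun k => Metric.isClosed_closedBall.measurableSet) k
  have hQu : ⋃ k, Q k = univ := by
    rw [hQ, iUnion_disjointed, eq_univ_iff_forall]
    intro y
    obtain ⟨k, hk⟩ := (TopologicalSpace.denseRange_denseSeq _).exists_dist_lt y
      (NNReal.coe_pos.2 hr)
    exact mem_iUnion.2 ⟨k, hk.le⟩
  have hvol : ∀ k, volume (Metric.closedBall (z k) (2 * r)) =
      volBallTwo d * (r : ℝ≥0∞) ^ (d : ℝ) := by
    intro k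
    rw [volBallTwo, Measure.addHaar_closedBall _ _ (by positivity),
      Measure.addHaar_closedBall _ _ (by norm_num), finrank_euclideanSpace_fin, mul_pow,
      ENNReal.ofReal_mul (by positivity), ENNReal.ofReal_pow (p := (r : ℝ)) (by positivity),
      ENNReal.ofReal_coe_nnreal, ENNReal.rpow_natCast]
    ring
  have hsub : {ω | edist (X s ω) (X (s + t) ω) ≤ r} ⊆
      ⋃ k, (X s ⁻¹' Q k ∩ X (s + t) ⁻¹' Metric.closedBall (z k) (2 * r)) := by
    intro ω hω
    obtain ⟨k, hk⟩ := mem_iUnion.1 (hQu.symm ▸ mem_univ (X s ω) : X s ω ∈ ⋃ k, Q k)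
    refine mem_iUnion.2 ⟨k, hk, ?_⟩
    have h1 : dist (X s ω) (z k) ≤ r := disjointed_subset _ k hk
    have h2 : dist (X s ω) (X (s + t) ω) ≤ r := by
      rw [mem_ofPred_eq, edist_nndist, ENNReal.coe_le_coe] at hω
      exact_mod_cast hω
    rw [mem_preimage, Metric.mem_closedBall]
    calc dist (X (s + t) ω) (z k) ≤ dist (X (s + t) ω) (X s ω) + dist (X s ω) (z k) :=
          dist_triangle _ _ _
      _ ≤ r + r := add_le_add (by rwa [dist_comm]) h1
      _ = 2 * r := by ring
  calc P x {ω | edist (X s ω) (X (s + t) ω) ≤ r}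
      ≤ ∑' k, P x (X s ⁻¹' Q k ∩ X (s + t) ⁻¹' Metric.closedBall (z k) (2 * r)) :=
        (measure_mono hsub).trans (measure_iUnion_le _)
    _ ≤ ∑' k, ENNReal.ofReal κ * (volBallTwo d * (r : ℝ≥0∞) ^ (d : ℝ)) * P x (X s ⁻¹' Q k) :=
        ENNReal.tsum_le_tsum fun k => by
          rw [← hvol k]
          exact measure_inter_preimage_le hX hp ht hκ x s (hQm k)
            Metric.isClosed_closedBall.measurableSet measure_closedBall_lt_top.ne
    _ = ENNReal.ofReal κ * (volBallTwo d * (r : ℝ≥0∞) ^ (d : ℝ)) * P x (⋃ k, X s ⁻¹' Q k) := by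
        rw [ENNReal.tsum_mul_left, measure_iUnion _ fun k => hX.measurable s (hQm k)]
        exact fun i j hij => (disjoint_disjointed _ hij).preimage _
    _ = _ := by rw [← preimage_iUnion, hQu, preimage_univ, measure_univ, mul_one, mul_assoc]

/-- Negative moments of the increments. -/
lemma lintegral_edist_rpow_neg_le (hX : IsFellerProcess P X) (hp : IsTransitionDensity P X p)
    {α : ℝ} (hα : 0 < α) {c : ℝ}
    (hbound : ∀ t : ℝ≥0, 0 < t → t ≤ 1 → ∀ x y : EuclideanSpace ℝ (Fin d),
      p t x y ≤ c * (t : ℝ) ^ (-((d : ℝ) / α)))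
    {b : ℝ} (hb : 0 < b) (x : EuclideanSpace ℝ (Fin d)) {u v : ℝ≥0} (hu : u ≤ 1) (hv : v ≤ 1) :
    ∫⁻ ω, edist (X u ω) (X v ω) ^ (-b) ∂(P x) ≤
      (1 + layerConst d b * (ENNReal.ofReal c * volBallTwo d)) * edist u v ^ (-(b / α)) := by
  have := hX.isProbabilityMeasure
  wlog huv : u ≤ v generalizing u v
  · simp_rw [edist_comm (X u _), edist_comm u]
    exact this hv hu (le_of_not_ge huv)
  rcases huv.eq_or_lt with rfl | huv
  -- On the diagonal the right side is `∞`; the summand `1` keeps the constant nonzero.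
  · rw [edist_self, ENNReal.zero_rpow_of_neg (neg_lt_zero.2 (by positivity)), ENNReal.mul_top]
    · exact le_top
    · simp
  obtain ⟨t, rfl⟩ := exists_add_of_le huv.le
  have ht : 0 < t := by simpa using huv
  have ht1 : t ≤ 1 := le_add_self.trans hv
  have hedist : edist u (u + t) = t := by
    rw [edist_nndist, NNReal.nndist_eq, add_tsub_cancel_left, max_eq_right]
    rw [tsub_eq_zero_of_le le_self_add]
    exact zero_le
  have htE : (t : ℝ≥0∞) ≠ 0 := by simpa using ht.ne'
  -- At the cutoff `t ^ (1/α)` both layer cake terms are of order `t ^ (-b/α)`; the second is `t ^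
  -- (-d/α) * t ^ ((d - b)/α)`.
  have hρ : (0 : ℝ≥0) < t ^ α⁻¹ := NNReal.rpow_pos ht
  have hmeas : Measurable fun ω => edist (X u ω) (X (u + t) ω) :=
    (hX.measurable _).edist (hX.measurable _)
  refine (lintegral_rpow_neg_le (P x) hmeas hb hρ fun r hr _ =>
    measure_edist_increment_le hX hp ht (hbound t ht ht1) x u hr).trans (le_of_eq ?_)
  rw [hedist, measure_univ, mul_one, ENNReal.coe_rpow_of_ne_zero ht.ne',
    ENNReal.ofReal_mul' (by positivity), ← ENNReal.ofReal_rpow_of_pos (NNReal.coe_pos.2 ht),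
    ENNReal.ofReal_coe_nnreal, ← ENNReal.rpow_mul,
    ← ENNReal.rpow_mul, add_mul, one_mul, mul_neg, ← div_eq_inv_mul]
  congr 1
  have : (t : ℝ≥0∞) ^ (-(b / α)) = (t : ℝ≥0∞) ^ (-((d : ℝ) / α)) * (t : ℝ≥0∞) ^ (α⁻¹ * (d - b)) := by
    rw [← ENNReal.rpow_add _ _ htE ENNReal.coe_ne_top]
    congr 1
    ring
  rw [this]
  ring

/-- The almost sure lower bound for the image of the process for a fixed exponent. -/
lemma ae_le_dimH_image (hX : IsFellerProcess P X) (hp : IsTransitionDensity P X p)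
    {α : ℝ} (hα : 0 < α) {c : ℝ}
    (hbound : ∀ t : ℝ≥0, 0 < t → t ≤ 1 → ∀ x y : EuclideanSpace ℝ (Fin d),
      p t x y ≤ c * (t : ℝ) ^ (-((d : ℝ) / α)))
    {E : Set ℝ≥0} (hE : E ⊆ Icc 0 1) (hEan : AnalyticSet E) (x : EuclideanSpace ℝ (Fin d))
    {b : ℝ≥0} (hb : 0 < b) (hbd : (b : ℝ) < d) (hbE : ENNReal.ofReal (b / α) < dimH E) :
    ∀ᵐ ω ∂(P x), (b : ℝ≥0∞) ≤ dimH ((fun t => X t ω) '' E) := by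
  have := hX.isProbabilityMeasure
  have hb' : (0 : ℝ) < b := hb
  obtain ⟨γ, hbγ, hγE⟩ := ENNReal.lt_iff_exists_nnreal_btwn.1 hbE
  have hbγ' : (b : ℝ) / α < γ := by
    rw [ENNReal.ofReal, ENNReal.coe_lt_coe, ← NNReal.coe_lt_coe, Real.coe_toNNReal _
      (by positivity)] at hbγ
    exact hbγ
  have hbα : 0 < (b : ℝ) / α := by positivity
  have hγ0 : 0 < γ := NNReal.coe_pos.1 (hbα.trans hbγ')
  obtain ⟨μ, _, hμ0, hμE, C, hμ⟩ := exists_frostman_measure hEan hE hγ0 hγE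
  obtain ⟨Y, hYm, hYX⟩ := exists_measurable_uncurry_of_ae_rightContinuous (μ := P x) hX.measurable
    ((hX.cadlag x).mono fun ω h t => (h t).1)
  set F : ℝ≥0 → ℝ≥0 → Ω → ℝ≥0∞ := fun u v ω => edist (Y u ω) (Y v ω) ^ (-(b : ℝ)) with hF
  have hFm : Measurable fun q : (ℝ≥0 × ℝ≥0) × Ω => F q.1.1 q.1.2 q.2 := by
    have h1 : Measurable fun q : (ℝ≥0 × ℝ≥0) × Ω => Y q.1.1 q.2 :=
      hYm.comp ((measurable_fst.comp measurable_fst).prodMk measurable_snd)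
    have h2 : Measurable fun q : (ℝ≥0 × ℝ≥0) × Ω => Y q.1.2 q.2 :=
      hYm.comp ((measurable_snd.comp measurable_fst).prodMk measurable_snd)
    exact (h1.edist h2).pow_const _
  set I : Ω → ℝ≥0∞ := fun ω => ∫⁻ q, F q.1 q.2 ω ∂(μ.prod μ) with hI
  have hIm : Measurable I := hFm.lintegral_prod_left'
  set A : ℝ≥0∞ := 1 + layerConst d b * (ENNReal.ofReal c * volBallTwo d) with hA
  have hAt : A ≠ ∞ := ENNReal.add_ne_top.2 ⟨ENNReal.one_ne_top, ENNReal.mul_ne_top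
    (layerConst_ne_top hbd) (ENNReal.mul_ne_top ENNReal.ofReal_ne_top
      measure_closedBall_lt_top.ne)⟩
  set B : ℝ≥0∞ := μ univ + layerConst γ (b / α) * C with hB
  have hBt : B ≠ ∞ := ENNReal.add_ne_top.2 ⟨measure_ne_top _ _, ENNReal.mul_ne_top
    (layerConst_ne_top hbγ') ENNReal.coe_ne_top⟩
  have hpot : ∀ u : ℝ≥0, ∫⁻ v, edist u v ^ (-((b : ℝ) / α)) ∂μ ≤ B := by
    intro u
    have h := lintegral_rpow_neg_le μ (D := fun v => edist u v) (by fun_prop) hbα one_pos (hμ u)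
    simpa only [ENNReal.coe_one, ENNReal.one_rpow, one_mul, mul_one] using h
  have hμE' : ∀ᵐ u ∂μ, u ∈ E := measure_eq_zero_iff_ae_notMem.1 hμE |>.mono fun u hu => not_not.1 hu
  have hIle : ∫⁻ ω, I ω ∂(P x) ≤ A * (B * μ univ) :=
    calc ∫⁻ ω, I ω ∂(P x) = ∫⁻ q, ∫⁻ ω, F q.1 q.2 ω ∂(P x) ∂(μ.prod μ) :=
          lintegral_lintegral_swap (hFm.comp measurable_swap).aemeasurable
      _ = ∫⁻ u, ∫⁻ v, ∫⁻ ω, F u v ω ∂(P x) ∂μ ∂μ :=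
          lintegral_prod _ hFm.lintegral_prod_right'.aemeasurable
      _ ≤ ∫⁻ u, ∫⁻ v, A * edist u v ^ (-((b : ℝ) / α)) ∂μ ∂μ := by
          refine lintegral_mono_ae (hμE'.mono fun u hu => lintegral_mono_ae
            (hμE'.mono fun v hv => ?_))
          refine le_trans (le_of_eq (lintegral_congr_ae ?_))
            (lintegral_edist_rpow_neg_le hX hp hα hbound hb' x (hE hu).2 (hE hv).2)
          filter_upwards [hYX] with ω hω
          simp only [hF, hω]
      _ ≤ ∫⁻ _, A * B ∂μ := lintegral_mono fun u => by
          rw [lintegral_const_mul' _ _ hAt]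
          exact mul_le_mul_right (hpot u) _
      _ = A * (B * μ univ) := by rw [lintegral_const, mul_assoc]
  have hIfin : ∀ᵐ ω ∂(P x), I ω < ∞ := ae_lt_top hIm (ne_top_of_le_ne_top
    (ENNReal.mul_ne_top hAt (ENNReal.mul_ne_top hBt (measure_ne_top _ _))) hIle)
  filter_upwards [hIfin, hYX] with ω hω hYω
  have himage : (fun t => X t ω) '' E = (fun t => Y t ω) '' E := by simp only [hYω]
  rw [himage]
  refine le_dimH_image_of_energy_ne_top (hYm.comp measurable_prodMk_right) hμ0 hμE ?_
  have h := lintegral_prod (μ := μ) (ν := μ) (fun q : ℝ≥0 × ℝ≥0 => F q.1 q.2 ω)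
    (hFm.comp measurable_prodMk_right).aemeasurable
  exact h ▸ hω.ne

end Feller

/-! ### Passage to the supremum over rational exponents -/

lemma dimH_nnreal_le_one (E : Set ℝ≥0) : dimH E ≤ 1 := by
  have hiso : Isometry ((↑) : ℝ≥0 → ℝ) := isometry_subtype_coe
  rw [← hiso.dimH_image]
  exact (dimH_mono (subset_univ _)).trans Real.dimH_univ.le

theorem theorem1p4 {d : ℕ} {Ω : Type*} [MeasurableSpace Ω]
    (P : EuclideanSpace ℝ (Fin d) → Measure Ω) (X : ℝ≥0 → Ω → EuclideanSpace ℝ (Fin d))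
    (hX : IsFellerProcess P X)
    (p : ℝ≥0 → EuclideanSpace ℝ (Fin d) → EuclideanSpace ℝ (Fin d) → ℝ)
    (hp : IsTransitionDensity P X p)
    (α : ℝ) (hα0 : 0 < α) (hα2 : α < 2) (c : ℝ)
    (hbound : ∀ t : ℝ≥0, 0 < t → t ≤ 1 → ∀ x y : EuclideanSpace ℝ (Fin d),
      p t x y ≤ c * (t : ℝ) ^ (-((d : ℝ) / α)))
    (E : Set ℝ≥0) (hE : E ⊆ Icc 0 1) (hEan : AnalyticSet E)
    (x : EuclideanSpace ℝ (Fin d)) :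
    ∀ᵐ ω ∂(P x),
      ENNReal.ofReal (min α (d : ℝ)) * dimH E ≤ dimH ((fun t => X t ω) '' E) := by
  have key : ∀ q : ℚ, ∀ᵐ ω ∂(P x),
      ENNReal.ofReal q < ENNReal.ofReal (min α (d : ℝ)) * dimH E →
        ENNReal.ofReal q ≤ dimH ((fun t => X t ω) '' E) := by
    intro q
    by_cases hq : ENNReal.ofReal q < ENNReal.ofReal (min α (d : ℝ)) * dimH E
    swap
    · exact Eventually.of_forall fun ω h => absurd h hq
    rcases le_or_gt (q : ℝ) 0 with hq0 | hq0
    · exact Eventually.of_forall fun ω _ => by simp [ENNReal.ofReal_of_nonpos hq0]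
    have hα' : ENNReal.ofReal α ≠ 0 := (ENNReal.ofReal_pos.2 hα0).ne'
    have h1 : ENNReal.ofReal q < ENNReal.ofReal (d : ℝ) := by
      refine hq.trans_le ?_
      calc _ ≤ ENNReal.ofReal (d : ℝ) * 1 := by
            gcongr
            · exact min_le_right _ _
            · exact dimH_nnreal_le_one E
        _ = _ := mul_one _
    have h2 : ENNReal.ofReal (q / α) < dimH E := by
      rw [ENNReal.ofReal_div_of_pos hα0]
      refine ENNReal.div_lt_of_lt_mul' (hq.trans_le ?_)
      gcongr
      exact min_le_left _ _
    have hcoe : ((q : ℝ).toNNReal : ℝ) = q := Real.coe_toNNReal _ hq0.le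
    refine (ae_le_dimH_image hX hp hα0 hbound hE hEan x (b := (q : ℝ).toNNReal)
      (Real.toNNReal_pos.2 hq0) ?_ ?_).mono fun ω h _ => h
    · rw [hcoe]
      exact lt_of_not_ge fun h => h1.not_ge (ENNReal.ofReal_le_ofReal h)
    · rwa [hcoe]
  filter_upwards [ae_all_iff.2 key] with ω hω
  refine le_of_forall_lt fun a ha => ?_
  obtain ⟨q, -, haq, hq⟩ := ENNReal.lt_iff_exists_rat_btwn.1 ha
  exact haq.trans_le (hω q hq)
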